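/- Let $m\ge 1$, and let $K,V\subset\mathbb R^m$ be convex bodies (compact convex sets with non-empty interior), symmetric with respect to the origin. Write $(x,y)=\sum_j x_jy_j$, let $K^*=\{t\in\mathbb R^m:\ |(t,y)|\le 1\ \text{for all } y\in K\}$ be the polar of $K$, and put $$\|z\|_K=\max_{t\in K^*}\Big|\sum_j t_jz_j\Big|,\qquad \|z\|_{V^*}=\max_{t\in V}\Big|\sum_j t_jz_j\Big|\qquad (z\in\mathbb C^m),$$ $$M=M(K,V)=\max_{y\in V}\|y\|_K,\qquad \mathcal A=\{\mathbf a\in\partial V:\ \|\mathbf a\|_K=M\}.$$ Let $B_V$ be the set of entire functions $f:\mathbb C^m\to\mathbb C$ such that for every $\varepsilon>0$ there is a $C>0$ with $|f(z)|\le C\exp[(1+\varepsilon)\|z\|_{V^*}]$ for all $z\in\mathbb C^m$. Let $B_V\cap C(\mathbb R^m)$ be the set of those $f\in B_V$ that are bounded on $\mathbb R^m$, put $\|f\|=\sup_{x\in\mathbb R^m}|f(x)|$ for such $f$, and let $\nabla f(x)=(\partial f/\partial x_1,\dots,\partial f/\partial x_m)(x)\in\mathbb C^m$ for $x\in\mathbb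 R^m$. Then $\mathcal A\ne\emptyset$ and the following hold. (a) For every $f\in B_V\cap C(\mathbb R^m)$ and every $x\in\mathbb R^m$, $$\|\nabla f(x)\|_K\le M\,\|f\|.$$ For all $\mathbf a\in\mathcal A$ and $C_1,C_2\in\mathbb C$, the function $f_0(x)=C_1e^{i(\mathbf a,x)}+C_2e^{-i(\mathbf a,x)}$ belongs to $B_V\cap C(\mathbb R^m)$, $\|f_0\|=|C_1|+|C_2|$, and there is an $x_0\in\mathbb R^m$ with $\|\nabla f_0(x_0)\|_K=M\|f_0\|$. Hence the inequality is sharp: $M$ is the smallest constant for which it holds for all $f\in B_V\cap C(\mathbb R^m)$ and all $x\in\mathbb R^m$. (b) For every $f\in B_V\cap C(\mathbb R^m)$ that is real-valued on $\mathbb R^m$, and every $x\in\mathbb R^m$, $$\|\nabla f(x)\|_K^2+M^2f(x)^2\le M^2\|f\|^2.$$ For every $\mathbf a\in\mathcal A$ there is an $x_0\in\mathbb R^m$ such that for all $R_1,R_2\in\mathbb R$ the function $f_0(x)=R_1\cos(\mathbf a,x)+R_2\sin(\mathbf a,x)$, which belongs to $B_V\cap C(\mathbb R^m)$, is real-valued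 on $\mathbb R^m$ and has $\|f_0\|=(R_1^2+R_2^2)^{1/2}$, satisfies $\|\nabla f_0(x_0)\|_K^2+M^2f_0(x_0)^2=M^2\|f_0\|^2$. Hence the inequality is sharp: $M$ is the smallest constant $C\ge 0$ such that $\|\nabla f(x)\|_K^2+C^2f(x)^2\le C^2\|f\|^2$ for all $f\in B_V\cap C(\mathbb R^m)$ that are real-valued on $\mathbb R^m$ and all $x\in\mathbb R^m$. -/

import Mathlib

namespace ExpType

/-- The Euclidean space `ℝ^m`. -/
abbrev RSp (m : ℕ) : Type := EuclideanSpace ℝ (Fin m)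

/-- The complex space `ℂ^m`. -/
abbrev CSp (m : ℕ) : Type := EuclideanSpace ℂ (Fin m)

/-- Centrally symmetric (with respect to the origin) convex bodies in `ℝ^m`: compact convex sets
with non-empty interior which are symmetric about `0`. -/
structure IsSymmConvexBody {m : ℕ} (K : Set (RSp m)) : Prop where
  isCompact : IsCompact K
  convex : Convex ℝ K
  interior_nonempty : (interior K).Nonempty
  symmetric : ∀ x ∈ K, -x ∈ K

/-- The polar `V^* = {y ∈ ℝ^m : ∀ t ∈ V, |(t, y)| ≤ 1}`. -/
def polarBody {m : ℕ} (V : Set (RSp m)) : Set (RSp m) :=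
  (innerₗ (RSp m)).polar V

/-- The bilinear pairing `∑ j, t_j z_j` of a real vector `t` with a real or complex vector `z`. -/
noncomputable def pairing {𝕜 : Type*} [RCLike 𝕜] {m : ℕ} (t : RSp m)
    (z : EuclideanSpace 𝕜 (Fin m)) : 𝕜 :=
  ∑ j, ((t j : ℝ) : 𝕜) * z j

/-- The norm `‖z‖_{V^*} = max_{t ∈ V} |∑ j, t_j z_j|` on `ℝ^m` and on `ℂ^m`, given `V`. -/
noncomputable def dualNorm {𝕜 : Type*} [RCLike 𝕜] {m : ℕ} (V : Set (RSp m))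
    (z : EuclideanSpace 𝕜 (Fin m)) : ℝ :=
  sSup ((fun t : RSp m => ‖pairing t z‖) '' V)

/-- The norm `‖z‖_K = max_{t ∈ K^*} |∑ j, t_j z_j|` on `ℝ^m` and on `ℂ^m`, given `K`. -/
noncomputable def bodyNorm {𝕜 : Type*} [RCLike 𝕜] {m : ℕ} (K : Set (RSp m))
    (z : EuclideanSpace 𝕜 (Fin m)) : ℝ :=
  dualNorm (polarBody K) z

/-- The constant `M(K, V) = max_{y ∈ V} ‖y‖_K`. -/
noncomputable def bernsteinConst {m : ℕ} (K V : Set (RSp m)) : ℝ :=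
  sSup ((fun y : RSp m => bodyNorm K y) '' V)

/-- The set `𝒜(K, V)` of all `a ∈ ∂V` with `‖a‖_K = M(K, V)`. -/
def extremalPoints {m : ℕ} (K V : Set (RSp m)) : Set (RSp m) :=
  {a | a ∈ frontier V ∧ bodyNorm K a = bernsteinConst K V}

/-- The inclusion of `ℝ^m` in `ℂ^m`. -/
noncomputable def toComplex {m : ℕ} (x : RSp m) : CSp m :=
  WithLp.toLp 2 (fun j => ((x j : ℝ) : ℂ))

/-- The restriction to `ℝ^m` of a function on `ℂ^m`. -/
noncomputable def restr {m : ℕ} (f : CSp m → ℂ) : RSp m → ℂ :=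
  fun x => f (toComplex x)

/-- The uniform norm `‖g‖_{C(ℝ^m)} = sup_x |g(x)|` (for bounded `g`). -/
noncomputable def unifNorm {m : ℕ} (g : RSp m → ℂ) : ℝ :=
  ⨆ x, ‖g x‖

/-- The gradient vector `(∂g/∂x_1, …, ∂g/∂x_m) ∈ ℂ^m` of a differentiable `g : ℝ^m → ℂ`. -/
noncomputable def grad {m : ℕ} (g : RSp m → ℂ) (x : RSp m) : CSp m :=
  WithLp.toLp 2 (fun j => fderiv ℝ g x (EuclideanSpace.single j (1 : ℝ)))

/-- The set `B_V` of entire functions of exponential type `V` on `ℂ^m`. -/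
def expTypeFun {m : ℕ} (V : Set (RSp m)) : Set (CSp m → ℂ) :=
  {f | Differentiable ℂ f ∧
    ∀ ε : ℝ, 0 < ε → ∃ C : ℝ, 0 < C ∧
      ∀ z : CSp m, ‖f z‖ ≤ C * Real.exp ((1 + ε) * dualNorm V z)}

/-- The set `B_V ∩ C(ℝ^m)`: functions from `B_V` whose restriction to `ℝ^m` is continuous and
bounded. -/
def bddExpTypeFun {m : ℕ} (V : Set (RSp m)) : Set (CSp m → ℂ) :=
  {f | f ∈ expTypeFun V ∧ Continuous (restr f) ∧ BddAbove (Set.range fun x => ‖restr f x‖)}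

/-- `f` takes real values on `ℝ^m`. -/
def IsRealValued {m : ℕ} (f : CSp m → ℂ) : Prop :=
  ∀ x : RSp m, (restr f x).im = 0

/-- The function `C₁ exp(i(a, z)) + C₂ exp(-i(a, z))` on `ℂ^m`. -/
noncomputable def expWave {m : ℕ} (a : RSp m) (C₁ C₂ : ℂ) : CSp m → ℂ :=
  fun z => C₁ * Complex.exp (Complex.I * pairing a z)
    + C₂ * Complex.exp (-(Complex.I * pairing a z))

/-- The function `R₁ cos (a, z) + R₂ sin (a, z)` on `ℂ^m`. -/
noncomputable def trigWave {m : ℕ} (a : RSp m) (R₁ R₂ : ℝ) : CSp m → ℂ :=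
  fun z => (R₁ : ℂ) * Complex.cos (pairing a z) + (R₂ : ℂ) * Complex.sin (pairing a z)

end ExpType

open ExpType

namespace ExpType

/-! ### One-variable theory: the Bernstein and Duffin–Schaeffer inequalities at the origin. -/

section Bernstein

open Filter Topology Set

/-! The pairing of `∇f(x)` with a real vector `t` is the derivative at `0` of `z ↦ f(x + z t)`. For
`t ∈ K^*` this entire function has exponential type `M` (`line_growth`) and is bounded by `‖f‖` on
the real line, so both inequalities reduce to one variable; taking the supremum over `t ∈ K^*`
recovers `‖∇f(x)‖_K`.

In one variable, let `F` have type `τ` and values in `[-1, 1]` on `ℝ`. Each `T_n ∘ F` has type `n τ`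
and is bounded by `1` on `ℝ`, so Phragmén–Lindelöf gives `|T_n(F(iy))| ≤ e^{nτy}` for `y ≥ 0`.
Writing `F(iy) = cos ζ` and letting `n` grow yields `|Im ζ| ≤ τ y`: the point `F(iy)` lies in the
ellipse with semi-axes `cosh τy` and `sinh τy` (`ellipse_bound`). As `y → 0` this becomes `F'(0)² +
τ² F(0)² ≤ τ²`. Symmetrisation extends it to real parts, and a rotation then gives Bernstein's
inequality.

Equality comes from plane waves with frequency `a ∈ 𝒜`, whose gradients are scalar multiples of `a`.
-/

lemma normSq_cos (ζ : ℂ) : ‖Complex.cos ζ‖ ^ 2 = Real.cos ζ.re ^ 2 + Real.sinh ζ.im ^ 2 := by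
  have h := Complex.cos_eq ζ
  rw [← Complex.normSq_eq_norm_sq, h, ← Complex.ofReal_cos, ← Complex.ofReal_sin,
    ← Complex.ofReal_cosh, ← Complex.ofReal_sinh, Complex.normSq_apply]
  simp only [Complex.sub_re, Complex.sub_im, Complex.mul_re, Complex.mul_im, Complex.ofReal_re,
    Complex.ofReal_im, Complex.I_re, Complex.I_im]
  have h1 := Real.cosh_sq ζ.im
  have h2 := Real.sin_sq_add_cos_sq ζ.re
  linear_combination Real.cos ζ.re ^ 2 * h1 + Real.sinh ζ.im ^ 2 * h2

lemma re_cos (ζ : ℂ) : (Complex.cos ζ).re = Real.cos ζ.re * Real.cosh ζ.im := by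
  rw [Complex.cos_eq ζ, ← Complex.ofReal_cos, ← Complex.ofReal_sin,
    ← Complex.ofReal_cosh, ← Complex.ofReal_sinh]
  simp only [Complex.sub_re, Complex.mul_re, Complex.mul_im, Complex.ofReal_re,
    Complex.ofReal_im, Complex.I_re, Complex.I_im]
  ring

lemma im_cos (ζ : ℂ) : (Complex.cos ζ).im = -(Real.sin ζ.re * Real.sinh ζ.im) := by
  rw [Complex.cos_eq ζ, ← Complex.ofReal_cos, ← Complex.ofReal_sin,
    ← Complex.ofReal_cosh, ← Complex.ofReal_sinh]
  simp only [Complex.sub_im, Complex.mul_re, Complex.mul_im, Complex.ofReal_re,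
    Complex.ofReal_im, Complex.I_re, Complex.I_im]
  ring

/-- With the two bounds that follow, this makes `|cos ζ|` comparable to `e^{|Im ζ|}`. -/
lemma sinh_abs_im_le_norm_cos (ζ : ℂ) : Real.sinh |ζ.im| ≤ ‖Complex.cos ζ‖ := by
  apply le_of_sq_le_sq _ (norm_nonneg _)
  rw [normSq_cos, ← Real.abs_sinh, sq_abs]
  nlinarith [sq_nonneg (Real.cos ζ.re)]

lemma norm_cos_le_exp (ζ : ℂ) : ‖Complex.cos ζ‖ ≤ Real.exp |ζ.im| := by
  have h1 : ‖Complex.cos ζ‖ ≤ Real.cosh |ζ.im| := by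
    apply le_of_sq_le_sq _ (Real.cosh_pos _).le
    rw [normSq_cos, Real.cosh_abs, Real.cosh_sq]
    nlinarith [Real.cos_sq_le_one ζ.re]
  refine h1.trans ?_
  rw [Real.cosh_eq]
  have : Real.exp (-|ζ.im|) ≤ Real.exp |ζ.im| :=
    Real.exp_le_exp.2 (by linarith [abs_nonneg ζ.im])
  linarith

lemma exp_abs_im_le (ζ : ℂ) : Real.exp |ζ.im| ≤ 2 * ‖Complex.cos ζ‖ + 1 := by
  have h := sinh_abs_im_le_norm_cos ζ
  rw [Real.sinh_eq] at h
  have : Real.exp (-|ζ.im|) ≤ 1 := Real.exp_le_one_iff.2 (by linarith [abs_nonneg ζ.im])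
  linarith

/-- Put `w = cos ζ`, so that `T_n(w) = cos nζ` has size at most `(e^{|Im ζ|})^n`. This controls the
type of `T_n ∘ F`. -/
lemma norm_chebyshev_le (n : ℕ) (w : ℂ) :
    ‖(Polynomial.Chebyshev.T ℂ n).eval w‖ ≤ (2 * ‖w‖ + 1) ^ n := by
  obtain ⟨ζ, rfl⟩ := Complex.cos_surjective w
  rw [Polynomial.Chebyshev.T_complex_cos]
  refine (norm_cos_le_exp _).trans ?_
  have : |((n : ℤ) * ζ : ℂ).im| = n * |ζ.im| := by
    simp [abs_mul]
  rw [this, Real.exp_nat_mul]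
  exact pow_le_pow_left₀ (Real.exp_pos _).le (exp_abs_im_le ζ) n

lemma norm_chebyshev_ofReal_le (n : ℕ) {r : ℝ} (hr : r ∈ Icc (-1 : ℝ) 1) :
    ‖(Polynomial.Chebyshev.T ℂ n).eval (r : ℂ)‖ ≤ 1 := by
  have h : (r : ℂ) = Complex.cos (Real.arccos r : ℝ) := by
    rw [← Complex.ofReal_cos, Real.cos_arccos hr.1 hr.2]
  rw [h, Polynomial.Chebyshev.T_complex_cos]
  refine (norm_cos_le_exp _).trans ?_
  simp

/-- Since `T_n(cos ζ) = cos nζ` grows like `e^{n|Im ζ|}` when `Im ζ ≠ 0`, its growth rate in `n`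
detects `|Im ζ|` without any loss from constants. -/
lemma abs_im_le_of_norm_chebyshev_le {ζ : ℂ} {s : ℝ} (hs : 0 ≤ s)
    (h : ∀ n : ℕ, ‖(Polynomial.Chebyshev.T ℂ n).eval (Complex.cos ζ)‖ ≤ Real.exp (n * s)) :
    |ζ.im| ≤ s := by
  by_contra! hlt
  -- With `δ = |Im ζ| - s`, the hypothesis gives `e^{nδ} ≤ 3`, while `1 + nδ ≤ e^{nδ}`; thus `nδ >
  -- 2` is contradictory.
  obtain ⟨n, hn⟩ := exists_nat_gt (2 / (|ζ.im| - s))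
  have hδ : 0 < |ζ.im| - s := sub_pos.2 hlt
  rw [div_lt_iff₀ hδ] at hn
  have h1 := h n
  rw [Polynomial.Chebyshev.T_complex_cos] at h1
  have h2 := exp_abs_im_le ((n : ℤ) * ζ : ℂ)
  have h3 : |((n : ℤ) * ζ : ℂ).im| = n * |ζ.im| := by
    simp [abs_mul]
  rw [h3] at h2
  have h4 : 1 ≤ Real.exp (n * s) := Real.one_le_exp (by positivity)
  have h5 : Real.exp (n * |ζ.im|) = Real.exp (n * s) * Real.exp (n * (|ζ.im| - s)) := by
    rw [← Real.exp_add]; ring_nf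
  have h6 := Real.add_one_le_exp ((n : ℝ) * (|ζ.im| - s))
  have h7 : Real.exp (n * s) * Real.exp (n * (|ζ.im| - s)) ≤ Real.exp (n * s) * 3 := by
    rw [← h5]; linarith
  have h8 := le_of_mul_le_mul_left h7 (by positivity)
  linarith

/-- Phragmén–Lindelöf for an entire function of exponential type bounded on the real line. -/
lemma norm_le_exp_of_expType {H : ℂ → ℂ} (hH : Differentiable ℂ H) {C τ : ℝ} (hτ : 0 ≤ τ)
    (hC : ∀ z, ‖H z‖ ≤ C * Real.exp (τ * ‖z‖)) (hreal : ∀ x : ℝ, ‖H x‖ ≤ 1) {y : ℝ} (hy : 0 ≤ y) :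
    ‖H (Complex.I * y)‖ ≤ Real.exp (τ * y) := by
  have hC0 : 0 ≤ C := by
    have := (norm_nonneg _).trans (hC 0)
    simpa using this
  -- The rotation carries the upper half-plane to the right one. The factor `e^{-τz}` keeps `g`
  -- bounded on the positive axis and has modulus `1` on the imaginary axis, where `H` is evaluated
  -- at real points.
  let g : ℂ → ℂ := fun z => H (Complex.I * z) * Complex.exp (-(τ * z))
  have hg : Differentiable ℂ g := by
    unfold g
    fun_prop
  have hnorm : ∀ z : ℂ, ‖g z‖ = ‖H (Complex.I * z)‖ * Real.exp (-(τ * z.re)) := by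
    intro z
    simp [g, Complex.norm_exp]
  have hre : ∀ x : ℝ, 0 ≤ x → ‖g x‖ ≤ C := by
    intro x hx
    rw [hnorm]
    have := hC (Complex.I * x)
    simp only [norm_mul, Complex.norm_I, one_mul, Complex.norm_real, Real.norm_eq_abs,
      abs_of_nonneg hx] at this
    calc _ ≤ C * Real.exp (τ * x) * Real.exp (-(τ * x)) := by
          simpa using mul_le_mul_of_nonneg_right this (Real.exp_pos _).le
      _ = C := by rw [mul_assoc, ← Real.exp_add]; simp
  have key : ‖g y‖ ≤ 1 := by
    refine PhragmenLindelof.right_half_plane_of_bounded_on_real hg.diffContOnCl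
      ⟨1, by norm_num, τ, ?_⟩ ?_ ?_ (by simpa using hy)
    · refine Asymptotics.IsBigO.of_bound C ?_
      refine Filter.eventually_inf_principal.2 (Filter.Eventually.of_forall fun z hz => ?_)
      rw [hnorm, Real.norm_eq_abs, Real.abs_exp, Real.rpow_one]
      have h1 := hC (Complex.I * z)
      simp only [norm_mul, Complex.norm_I, one_mul] at h1
      have h2 : Real.exp (-(τ * z.re)) ≤ 1 :=
        Real.exp_le_one_iff.2 (neg_nonpos.2 (mul_nonneg hτ (le_of_lt hz)))
      calc _ ≤ ‖H (Complex.I * z)‖ * 1 := by gcongr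
        _ ≤ _ := by simpa using h1
    · refine Filter.isBoundedUnder_of_eventually_le (a := C) ?_
      filter_upwards [eventually_ge_atTop (0 : ℝ)] with x hx using hre x hx
    · intro x
      rw [hnorm]
      have : Complex.I * (x * Complex.I) = ((-x : ℝ) : ℂ) := by
        push_cast
        linear_combination (x : ℂ) * Complex.I_mul_I
      rw [this]
      simpa using hreal (-x)
  rw [hnorm] at key
  have h2 := mul_le_mul_of_nonneg_right key (Real.exp_pos (τ * y)).le
  rw [mul_assoc, ← Real.exp_add] at h2
  simpa using h2

/-- On the imaginary axis, an entire function of exponential type `τ` with values in `[-1, 1]` on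
the real line lies in the image under `cos` of the strip `|Im ζ| ≤ τ y`. -/
lemma ellipse_bound {F : ℂ → ℂ} (hF : Differentiable ℂ F) {C τ : ℝ} (hτ : 0 ≤ τ)
    (hC : ∀ z, ‖F z‖ ≤ C * Real.exp (τ * ‖z‖))
    (hreal : ∀ x : ℝ, ∃ r ∈ Icc (-1 : ℝ) 1, F x = (r : ℝ)) {y : ℝ} (hy : 0 ≤ y) :
    (F (Complex.I * y)).re ^ 2 * Real.sinh (τ * y) ^ 2
      + (F (Complex.I * y)).im ^ 2 * Real.cosh (τ * y) ^ 2
      ≤ Real.sinh (τ * y) ^ 2 * Real.cosh (τ * y) ^ 2 := by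
  obtain ⟨ζ, hζ⟩ := Complex.cos_surjective (F (Complex.I * y))
  have hC0 : 0 ≤ C := by
    have := (norm_nonneg _).trans (hC 0)
    simpa using this
  have hty : 0 ≤ τ * y := mul_nonneg hτ hy
  have hb : |ζ.im| ≤ τ * y := by
    refine abs_im_le_of_norm_chebyshev_le hty fun n => ?_
    rw [hζ, ← mul_assoc]
    refine norm_le_exp_of_expType
      (H := fun z => (Polynomial.Chebyshev.T ℂ n).eval (F z)) (C := (2 * C + 1) ^ n)
      (Differentiable.fun_comp (Polynomial.differentiable (Polynomial.Chebyshev.T ℂ n)) hF) (by positivity) (fun z => ?_) (fun x => ?_) hy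
    · refine (norm_chebyshev_le n _).trans ?_
      rw [mul_assoc, Real.exp_nat_mul, ← mul_pow]
      refine pow_le_pow_left₀ (by positivity) ?_ n
      have := hC z
      have h1 : 1 ≤ Real.exp (τ * ‖z‖) := Real.one_le_exp (by positivity)
      nlinarith
    · obtain ⟨r, hr, h⟩ := hreal x
      simpa only [h] using norm_chebyshev_ofReal_le n hr
  rw [← hζ, re_cos, im_cos]
  have h1 : Real.sinh ζ.im ^ 2 ≤ Real.sinh (τ * y) ^ 2 := by
    rw [← sq_abs, Real.abs_sinh]
    exact pow_le_pow_left₀ (Real.sinh_nonneg_iff.2 (abs_nonneg _)) (Real.sinh_le_sinh.2 hb) 2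
  have h2 : Real.cosh ζ.im ^ 2 ≤ Real.cosh (τ * y) ^ 2 := by
    rw [Real.cosh_sq, Real.cosh_sq]; linarith
  have h3 := Real.sin_sq_add_cos_sq ζ.re
  -- The two terms are weighted by `cos²` and `sin²` of `Re ζ`, which sum to `1`.
  calc _ = Real.cos ζ.re ^ 2 * (Real.sinh (τ * y) ^ 2 * Real.cosh ζ.im ^ 2)
        + Real.sin ζ.re ^ 2 * (Real.sinh ζ.im ^ 2 * Real.cosh (τ * y) ^ 2) := by ring
    _ ≤ Real.cos ζ.re ^ 2 * (Real.sinh (τ * y) ^ 2 * Real.cosh (τ * y) ^ 2)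
        + Real.sin ζ.re ^ 2 * (Real.sinh (τ * y) ^ 2 * Real.cosh (τ * y) ^ 2) := by gcongr
    _ = _ := by linear_combination (Real.sinh (τ * y) ^ 2 * Real.cosh (τ * y) ^ 2) * h3

/-- The Duffin–Schaeffer inequality at the origin, normalised. -/
lemma duffin_schaeffer_aux {F : ℂ → ℂ} (hF : Differentiable ℂ F) {C τ : ℝ} (hτ : 0 ≤ τ)
    (hC : ∀ z, ‖F z‖ ≤ C * Real.exp (τ * ‖z‖))
    (hreal : ∀ x : ℝ, ∃ r ∈ Icc (-1 : ℝ) 1, F x = (r : ℝ)) :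
    (deriv F 0).re ^ 2 + τ ^ 2 * (F 0).re ^ 2 ≤ τ ^ 2 := by
  have him0 : (F 0).im = 0 := by
    obtain ⟨r, -, hr⟩ := hreal 0
    rw [← Complex.ofReal_zero, hr, Complex.ofReal_im]
  have hd : HasDerivAt (fun y : ℝ => F (Complex.I * y)) (deriv F 0 * Complex.I) 0 := by
    have h1 : HasDerivAt (fun y : ℂ => Complex.I * y) Complex.I ((0 : ℝ) : ℂ) := by
      simpa using (hasDerivAt_id ((0 : ℝ) : ℂ)).const_mul Complex.I
    have h2 : HasDerivAt F (deriv F 0) (Complex.I * ((0 : ℝ) : ℂ)) := by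
      simpa using (hF 0).hasDerivAt
    exact (h2.comp _ h1).comp_ofReal
  have hdim : HasDerivAt (fun y : ℝ => (F (Complex.I * y)).im) (deriv F 0).re 0 := by
    have := (Complex.imCLM.hasFDerivAt.comp_hasDerivAt (0 : ℝ) hd)
    simpa [Function.comp_def] using this
  have hsinh : HasDerivAt (fun y : ℝ => Real.sinh (τ * y)) τ 0 := by
    have h1 : HasDerivAt (fun y : ℝ => τ * y) τ 0 := by
      simpa using (hasDerivAt_id (0 : ℝ)).const_mul τ
    simpa using h1.sinh
  have l1 : Tendsto (fun y : ℝ => (F (Complex.I * y)).im / y) (𝓝[>] 0) (𝓝 (deriv F 0).re) := by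
    have := (hasDerivAt_iff_tendsto_slope.1 hdim).mono_left
      (nhdsWithin_mono (0 : ℝ) (fun x (hx : 0 < x) => hx.ne'))
    refine this.congr fun y => ?_
    simp [slope_def_field, him0]
  have l2 : Tendsto (fun y : ℝ => Real.sinh (τ * y) / y) (𝓝[>] 0) (𝓝 τ) := by
    have := (hasDerivAt_iff_tendsto_slope.1 hsinh).mono_left
      (nhdsWithin_mono (0 : ℝ) (fun x (hx : 0 < x) => hx.ne'))
    refine this.congr fun y => ?_
    simp [slope_def_field]
  have l3 : Tendsto (fun y : ℝ => Real.cosh (τ * y)) (𝓝[>] 0) (𝓝 1) := by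
    refine Tendsto.mono_left ?_ nhdsWithin_le_nhds
    exact Continuous.tendsto' (by fun_prop) _ _ (by simp)
  have l4 : Tendsto (fun y : ℝ => (F (Complex.I * y)).re) (𝓝[>] 0) (𝓝 (F 0).re) := by
    refine Tendsto.mono_left ?_ nhdsWithin_le_nhds
    have := hF.continuous
    exact Continuous.tendsto' (by fun_prop) _ _ (by simp)
  -- Divide the ellipse inequality by `y²` and let `y ↓ 0`.
  have := le_of_tendsto_of_tendsto
    (((l4.pow 2).mul (l2.pow 2)).add ((l1.pow 2).mul (l3.pow 2))) ((l2.pow 2).mul (l3.pow 2))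
    (by
      filter_upwards [self_mem_nhdsWithin] with y hy
      have hy : 0 < y := hy
      have h := ellipse_bound hF hτ hC hreal hy.le
      have h2 := div_le_div_of_nonneg_right h (sq_nonneg y)
      refine le_of_eq_of_le ?_ (h2.trans_eq ?_) <;> field_simp)
  linarith

/-- The Duffin–Schaeffer inequality at the origin, for the real part of an entire function on the
real line. -/
lemma duffin_schaeffer {F : ℂ → ℂ} (hF : Differentiable ℂ F) {C τ B : ℝ} (hτ : 0 ≤ τ)
    (hC : ∀ z, ‖F z‖ ≤ C * Real.exp (τ * ‖z‖)) (hB : ∀ x : ℝ, ‖F x‖ ≤ B) :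
    (deriv F 0).re ^ 2 + τ ^ 2 * (F 0).re ^ 2 ≤ τ ^ 2 * B ^ 2 := by
  have hB0 : 0 ≤ B := (norm_nonneg _).trans (hB 0)
  have key : ∀ D : ℝ, B < D →
      (deriv F 0).re ^ 2 + τ ^ 2 * (F 0).re ^ 2 ≤ τ ^ 2 * D ^ 2 := by
    intro D hD
    have hD0 : 0 < D := hB0.trans_lt hD
    -- On the real line `G` is `Re F / D`, yet it is entire of the same type. Using `D > B` instead
    -- of `B` covers `B = 0`; afterwards `D ↓ B`.
    let G : ℂ → ℂ := fun z => (F z + starRingEnd ℂ (F (starRingEnd ℂ z))) / (2 * D)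
    have hconj : ∀ z, HasDerivAt (starRingEnd ℂ ∘ F ∘ starRingEnd ℂ)
        (starRingEnd ℂ (deriv F (starRingEnd ℂ z))) z := by
      intro z
      simpa using (hF (starRingEnd ℂ z)).hasDerivAt.conj_conj
    have hG : ∀ z, HasDerivAt G
        ((deriv F z + starRingEnd ℂ (deriv F (starRingEnd ℂ z))) / (2 * D)) z := fun z =>
      ((hF z).hasDerivAt.add (hconj z)).div_const _
    have hDn : ‖(2 * D : ℂ)‖ = 2 * D := by
      simp [abs_of_pos hD0]
    have hGx : ∀ x : ℝ, G x = (((F x).re / D : ℝ) : ℂ) := by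
      intro x
      simp only [G, Complex.conj_ofReal, Complex.add_conj]
      push_cast
      have : (D : ℂ) ≠ 0 := by exact_mod_cast hD0.ne'
      field_simp
    have h := duffin_schaeffer_aux (F := G) (C := C / D) (fun z => (hG z).differentiableAt) hτ
      (fun z => by
        have h1 := hC z
        have h2 := hC (starRingEnd ℂ z)
        rw [RCLike.norm_conj] at h2
        simp only [G, norm_div, hDn]
        rw [div_le_iff₀ (by positivity)]
        refine (norm_add_le _ _).trans ?_
        rw [RCLike.norm_conj]
        refine (add_le_add h1 h2).trans_eq ?_
        field_simp
        ring)
      (fun x => by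
        refine ⟨(F x).re / D, ?_, hGx x⟩
        have h1 : |(F x).re| ≤ D := (Complex.abs_re_le_norm _).trans ((hB x).trans hD.le)
        rw [mem_Icc, ← abs_le, abs_div, abs_of_pos hD0]
        exact (div_le_one hD0).2 h1)
    have h0 : G 0 = (((F 0).re / D : ℝ) : ℂ) := by simpa using hGx 0
    have hd : deriv G 0 = (((deriv F 0).re / D : ℝ) : ℂ) := by
      rw [(hG 0).deriv, map_zero, Complex.add_conj]
      push_cast
      have : (D : ℂ) ≠ 0 := by exact_mod_cast hD0.ne'
      field_simp
    rw [h0, hd, Complex.ofReal_re, Complex.ofReal_re] at h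
    have h2 := mul_le_mul_of_nonneg_right h (sq_nonneg D)
    refine le_of_eq_of_le ?_ h2
    field_simp
  refine ge_of_tendsto (f := fun D : ℝ => τ ^ 2 * D ^ 2) (x := 𝓝[>] B) ?_ ?_
  · refine Tendsto.mono_left ?_ nhdsWithin_le_nhds
    exact Continuous.tendsto' (by fun_prop) _ _ rfl
  · filter_upwards [self_mem_nhdsWithin] with D hD using key D hD

/-- The Duffin–Schaeffer inequality for functions of type `σ + ε` for every `ε > 0`. -/
lemma duffin_schaeffer_of_forall {F : ℂ → ℂ} (hF : Differentiable ℂ F) {σ B : ℝ} (hσ : 0 ≤ σ)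
    (hC : ∀ τ, σ < τ → ∃ C, ∀ z, ‖F z‖ ≤ C * Real.exp (τ * ‖z‖)) (hB : ∀ x : ℝ, ‖F x‖ ≤ B) :
    (deriv F 0).re ^ 2 + σ ^ 2 * (F 0).re ^ 2 ≤ σ ^ 2 * B ^ 2 := by
  refine le_of_tendsto_of_tendsto (f := fun τ : ℝ => (deriv F 0).re ^ 2 + τ ^ 2 * (F 0).re ^ 2)
    (g := fun τ : ℝ => τ ^ 2 * B ^ 2) (b := 𝓝[>] σ) ?_ ?_ ?_
  · refine Tendsto.mono_left ?_ nhdsWithin_le_nhds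
    exact Continuous.tendsto' (by fun_prop) _ _ rfl
  · refine Tendsto.mono_left ?_ nhdsWithin_le_nhds
    exact Continuous.tendsto' (by fun_prop) _ _ rfl
  · filter_upwards [self_mem_nhdsWithin] with τ hτ
    obtain ⟨C, h⟩ := hC τ hτ
    exact duffin_schaeffer hF (hσ.trans (le_of_lt hτ)) h hB

/-- Bernstein's inequality at the origin. -/
lemma bernstein_of_forall {F : ℂ → ℂ} (hF : Differentiable ℂ F) {σ B : ℝ} (hσ : 0 ≤ σ)
    (hC : ∀ τ, σ < τ → ∃ C, ∀ z, ‖F z‖ ≤ C * Real.exp (τ * ‖z‖)) (hB : ∀ x : ℝ, ‖F x‖ ≤ B) :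
    ‖deriv F 0‖ ≤ σ * B := by
  have hB0 : 0 ≤ B := (norm_nonneg _).trans (hB 0)
  -- A unimodular factor turning `F'(0)` into its modulus, so that the bound on the real part
  -- suffices.
  let u : ℂ := Complex.exp (-((deriv F 0).arg * Complex.I))
  have hu : ‖u‖ = 1 := by simp [u, Complex.norm_exp]
  have hud : u * deriv F 0 = (‖deriv F 0‖ : ℂ) := by
    conv_lhs => rw [← Complex.norm_mul_exp_arg_mul_I (deriv F 0)]
    rw [mul_left_comm]
    simp [u, ← Complex.exp_add]
  have h := duffin_schaeffer_of_forall (F := fun z => u * F z) (hF.const_mul u) hσ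
    (fun τ hτ => by simpa [hu] using hC τ hτ) (by simpa [hu] using hB)
  rw [deriv_const_mul _ (hF 0), hud, Complex.ofReal_re] at h
  refine le_of_sq_le_sq ?_ (mul_nonneg hσ hB0)
  have : 0 ≤ σ ^ 2 * (u * F 0).re ^ 2 := by positivity
  rw [mul_pow]
  linarith

end Bernstein

/-! ### The bilinear pairing and the norms defined by it. -/

section Pairing

open Set

variable {𝕜 : Type*} [RCLike 𝕜] {m : ℕ}

lemma pairing_add (t : RSp m) (z w : EuclideanSpace 𝕜 (Fin m)) :
    pairing t (z + w) = pairing t z + pairing t w := by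
  simp [pairing, mul_add, Finset.sum_add_distrib]

lemma pairing_smul (t : RSp m) (c : 𝕜) (z : EuclideanSpace 𝕜 (Fin m)) :
    pairing t (c • z) = c * pairing t z := by
  simp only [pairing, PiLp.smul_apply, smul_eq_mul, Finset.mul_sum]
  exact Finset.sum_congr rfl fun j _ => mul_left_comm _ _ _

lemma continuous_pairing_left (z : EuclideanSpace 𝕜 (Fin m)) :
    Continuous fun t : RSp m => pairing t z := by
  unfold pairing
  have : Continuous (fun r : ℝ => (r : 𝕜)) := RCLike.continuous_ofReal
  fun_prop

lemma pairing_eq_inner (t y : RSp m) : pairing (𝕜 := ℝ) t y = inner ℝ t y := by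
  simp [pairing, PiLp.inner_apply, mul_comm]

lemma pairing_comm (t y : RSp m) : pairing (𝕜 := ℝ) t y = pairing (𝕜 := ℝ) y t := by
  rw [pairing_eq_inner, pairing_eq_inner, real_inner_comm]

lemma pairing_toComplex (t y : RSp m) :
    pairing t (toComplex y) = ((pairing (𝕜 := ℝ) t y : ℝ) : ℂ) := by
  simp [pairing, toComplex]

lemma le_dualNorm {V : Set (RSp m)} (hV : IsCompact V) {t : RSp m} (ht : t ∈ V)
    (z : EuclideanSpace 𝕜 (Fin m)) : ‖pairing t z‖ ≤ dualNorm V z :=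
  le_csSup (hV.bddAbove_image (continuous_pairing_left z).norm.continuousOn)
    (mem_image_of_mem _ ht)

lemma dualNorm_nonneg (V : Set (RSp m)) (z : EuclideanSpace 𝕜 (Fin m)) : 0 ≤ dualNorm V z :=
  Real.sSup_nonneg (by rintro _ ⟨t, -, rfl⟩; exact norm_nonneg _)

lemma dualNorm_le {V : Set (RSp m)} {z : EuclideanSpace 𝕜 (Fin m)} {B : ℝ} (hB : 0 ≤ B)
    (h : ∀ t ∈ V, ‖pairing t z‖ ≤ B) : dualNorm V z ≤ B :=
  Real.sSup_le (by rintro _ ⟨t, ht, rfl⟩; exact h t ht) hB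

/-- The two scalar fields may differ, so that a complex gradient can be compared with a real
frequency vector. -/
lemma dualNorm_eq_mul {𝕜' : Type*} [RCLike 𝕜'] {V : Set (RSp m)} {z : EuclideanSpace 𝕜 (Fin m)}
    {w : EuclideanSpace 𝕜' (Fin m)} {c : ℝ} (hc : 0 ≤ c)
    (h : ∀ t, ‖pairing t z‖ = c * ‖pairing t w‖) : dualNorm V z = c * dualNorm V w := by
  unfold dualNorm
  rw [← smul_eq_mul, ← Real.sSup_smul_of_nonneg hc, ← image_smul, image_image]
  simp only [h, smul_eq_mul]

end Pairing

/-! ### Polar bodies, the constant `M` and the extremal points. -/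

section Bodies

open Set Filter Topology

variable {m : ℕ} {K V : Set (RSp m)}

lemma mem_polarBody {t : RSp m} : t ∈ polarBody K ↔ ∀ x ∈ K, |inner ℝ x t| ≤ 1 := by
  simp [polarBody, LinearMap.polar_mem_iff]

lemma isCompact_polarBody (hK : IsSymmConvexBody K) : IsCompact (polarBody K) := by
  refine Metric.isCompact_of_isClosed_isBounded ?_ ?_
  · have : polarBody K = ⋂ x ∈ K, {t | |inner ℝ x t| ≤ 1} := by
      ext t
      simp [mem_polarBody]
    rw [this]
    exact isClosed_biInter fun x _ => isClosed_le (by fun_prop) continuous_const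
  · obtain ⟨y, hy⟩ := hK.interior_nonempty
    obtain ⟨r, hr, hball⟩ := Metric.nhds_basis_closedBall.mem_iff.1 (mem_interior_iff_mem_nhds.1 hy)
    refine (isBounded_iff_forall_norm_le).2 ⟨2 / r, fun t ht => ?_⟩
    rw [mem_polarBody] at ht
    rcases eq_or_ne t 0 with rfl | h0
    · simp only [norm_zero]; positivity
    have hn : 0 < ‖t‖ := norm_pos_iff.2 h0
    -- Test `t` at the centre of a ball inside `K` and at its boundary point in direction `t`; the
    -- difference of the two pairings is `r‖t‖ ≤ 2`.
    have h1 := abs_le.1 (ht y (hball (Metric.mem_closedBall_self hr.le)))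
    have h2 := abs_le.1 (ht (y + (r / ‖t‖) • t) (hball (by
      simp [norm_smul, abs_of_pos hr, hn.ne'])))
    rw [inner_add_left, real_inner_smul_left, real_inner_self_eq_norm_sq] at h2
    have h3 : r / ‖t‖ * ‖t‖ ^ 2 = r * ‖t‖ := by field_simp
    rw [h3] at h2
    rw [le_div_iff₀ hr]
    linarith [h1.1, h2.2]

/-- The maximum of `|(t, y)|` over `t ∈ K^*`, `y ∈ V` is positive and attained. -/
lemma exists_max_pairing (hm : 1 ≤ m) (hK : IsSymmConvexBody K) (hV : IsSymmConvexBody V) :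
    ∃ t ∈ polarBody K, ∃ a ∈ V, 0 < ‖pairing (𝕜 := ℝ) t a‖ ∧
      ∀ s ∈ polarBody K, ∀ y ∈ V, ‖pairing (𝕜 := ℝ) s y‖ ≤ ‖pairing (𝕜 := ℝ) t a‖ := by
  obtain ⟨y, hyV, hy0⟩ : ∃ y ∈ V, y ≠ 0 := by
    have : Nonempty (Fin m) := ⟨⟨0, hm⟩⟩
    by_contra! h
    have h1 : (interior V) ⊆ {0} := fun y hy => h y (interior_subset hy)
    have h2 := interior_maximal h1 isOpen_interior
    rw [interior_singleton] at h2
    exact hV.interior_nonempty.ne_empty (subset_empty_iff.1 h2)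
  obtain ⟨R, hR0, hR⟩ := hK.isCompact.isBounded.exists_pos_norm_le
  have hn : 0 < ‖y‖ := norm_pos_iff.2 hy0
  -- A small multiple of `y` lies in the polar and pairs positively with `y`, which makes the
  -- maximum positive.
  have hs : (1 / (R * ‖y‖)) • y ∈ polarBody K := by
    rw [mem_polarBody]
    intro x hx
    refine (abs_real_inner_le_norm _ _).trans ?_
    rw [norm_smul, Real.norm_eq_abs, abs_of_pos (by positivity)]
    calc ‖x‖ * (1 / (R * ‖y‖) * ‖y‖) ≤ R * (1 / (R * ‖y‖) * ‖y‖) := by gcongr; exact hR x hx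
      _ = 1 := by field_simp
  have hcont : Continuous fun p : RSp m × RSp m => ‖pairing (𝕜 := ℝ) p.1 p.2‖ := by
    simp only [pairing_eq_inner]
    fun_prop
  obtain ⟨p, hp, hmax⟩ := ((isCompact_polarBody hK).prod hV.isCompact).exists_isMaxOn
    ⟨(_, y), hs, hyV⟩ hcont.continuousOn
  have hmax' : ∀ s ∈ polarBody K, ∀ y ∈ V,
      ‖pairing (𝕜 := ℝ) s y‖ ≤ ‖pairing (𝕜 := ℝ) p.1 p.2‖ := fun s hs y hy => isMaxOn_iff.1 hmax (s, y) ⟨hs, hy⟩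
  refine ⟨p.1, hp.1, p.2, hp.2, lt_of_lt_of_le ?_ (hmax' _ hs y hyV), hmax'⟩
  rw [pairing_eq_inner, real_inner_smul_left, real_inner_self_eq_norm_sq, norm_pos_iff]
  positivity

lemma bernsteinConst_eq {t a : RSp m} (ht : t ∈ polarBody K) (ha : a ∈ V)
    (hK : IsSymmConvexBody K)
    (h : ∀ s ∈ polarBody K, ∀ y ∈ V, ‖pairing (𝕜 := ℝ) s y‖ ≤ ‖pairing (𝕜 := ℝ) t a‖) :
    bernsteinConst K V = ‖pairing (𝕜 := ℝ) t a‖ ∧ bodyNorm K a = ‖pairing (𝕜 := ℝ) t a‖ := by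
  have hle : ∀ y ∈ V, bodyNorm K y ≤ ‖pairing (𝕜 := ℝ) t a‖ := fun y hy =>
    dualNorm_le (norm_nonneg _) fun s hs => h s hs y hy
  have hge : ‖pairing (𝕜 := ℝ) t a‖ ≤ bodyNorm K a := le_dualNorm (isCompact_polarBody hK) ht a
  refine ⟨le_antisymm ?_ (hge.trans ?_), le_antisymm (hle a ha) hge⟩
  · exact Real.sSup_le (by rintro _ ⟨y, hy, rfl⟩; exact hle y hy) (norm_nonneg _)
  · exact le_csSup ⟨_, by rintro _ ⟨y, hy, rfl⟩; exact hle y hy⟩ (mem_image_of_mem _ ha)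

lemma bernsteinConst_pos (hm : 1 ≤ m) (hK : IsSymmConvexBody K) (hV : IsSymmConvexBody V) :
    0 < bernsteinConst K V := by
  obtain ⟨t, ht, a, ha, hpos, h⟩ := exists_max_pairing hm hK hV
  rwa [(bernsteinConst_eq ht ha hK h).1]

lemma norm_pairing_le_bernsteinConst (hm : 1 ≤ m) (hK : IsSymmConvexBody K)
    (hV : IsSymmConvexBody V) {s y : RSp m} (hs : s ∈ polarBody K) (hy : y ∈ V) :
    ‖pairing (𝕜 := ℝ) s y‖ ≤ bernsteinConst K V := by
  obtain ⟨t, ht, a, ha, -, h⟩ := exists_max_pairing hm hK hV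
  rw [(bernsteinConst_eq ht ha hK h).1]
  exact h s hs y hy

/-- A maximiser `a` of the pairing lies on the boundary: were it interior, `δ • a` with some `δ > 1`
would stay in `V` and increase the positive maximum. -/
lemma extremalPoints_nonempty (hm : 1 ≤ m) (hK : IsSymmConvexBody K)
    (hV : IsSymmConvexBody V) : (extremalPoints K V).Nonempty := by
  obtain ⟨t, ht, a, ha, hpos, h⟩ := exists_max_pairing hm hK hV
  obtain ⟨h1, h2⟩ := bernsteinConst_eq ht ha hK h
  refine ⟨a, ⟨subset_closure ha, fun hint => ?_⟩, h2.trans h1.symm⟩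
  have hcont : Tendsto (fun δ : ℝ => δ • a) (𝓝[>] 1) (𝓝 a) := by
    refine Tendsto.mono_left ?_ nhdsWithin_le_nhds
    exact Continuous.tendsto' (by fun_prop) _ _ (by simp)
  obtain ⟨δ, hδV, hδ⟩ := ((hcont.eventually_mem
    (mem_interior_iff_mem_nhds.1 hint)).and self_mem_nhdsWithin).exists
  have hδ : 1 < δ := hδ
  have := h t ht (δ • a) hδV
  rw [pairing_smul, norm_mul, Real.norm_eq_abs δ, abs_of_pos (by linarith)] at this
  nlinarith

lemma ne_zero_of_mem_extremalPoints (hm : 1 ≤ m) (hK : IsSymmConvexBody K)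
    (hV : IsSymmConvexBody V) {a : RSp m} (ha : a ∈ extremalPoints K V) : a ≠ 0 := by
  rintro rfl
  have h := ha.2
  have h0 : bodyNorm K (0 : RSp m) ≤ 0 := dualNorm_le le_rfl (by simp [pairing])
  linarith [bernsteinConst_pos hm hK hV]

end Bodies

/-! ### Reduction of the gradient inequalities to complex lines. -/

section Gradient

open Set

variable {m : ℕ} {K V : Set (RSp m)}

lemma pairing_grad (g : RSp m → ℂ) (x t : RSp m) :
    pairing t (grad g x) = fderiv ℝ g x t := by
  conv_rhs => rw [← (EuclideanSpace.basisFun (Fin m) ℝ).sum_repr t]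
  simp [pairing, grad, map_sum]

/-- The inclusion of `ℝ^m` in `ℂ^m` as a continuous linear map. -/
noncomputable def toComplexL (m : ℕ) : RSp m →L[ℝ] CSp m :=
  LinearMap.toContinuousLinearMap
    { toFun := toComplex
      map_add' := fun x y => by ext j; simp [toComplex]
      map_smul' := fun c x => by ext j; simp [toComplex] }

lemma continuous_restr {f : CSp m → ℂ} (hf : Continuous f) : Continuous (restr f) :=
  hf.comp (toComplexL m).continuous

lemma differentiable_line {f : CSp m → ℂ} (hf : Differentiable ℂ f) (w v : CSp m) :
    Differentiable ℂ fun z : ℂ => f (w + z • v) := by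
  fun_prop

lemma fderiv_restr {f : CSp m → ℂ} (hf : Differentiable ℂ f) (x t : RSp m) :
    fderiv ℝ (restr f) x t = deriv (fun z : ℂ => f (toComplex x + z • toComplex t)) 0 := by
  have h1 : HasFDerivAt (restr f)
      (((fderiv ℂ f (toComplex x)).restrictScalars ℝ).comp (toComplexL m)) x :=
    HasFDerivAt.comp (g := f) x ((hf (toComplex x)).hasFDerivAt.restrictScalars ℝ)
      (toComplexL m).hasFDerivAt
  have h2 : HasDerivAt (fun z : ℂ => toComplex x + z • toComplex t) (toComplex t) 0 := by
    simpa using ((hasDerivAt_id (0 : ℂ)).smul_const (toComplex t)).const_add (toComplex x)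
  have h3 : HasFDerivAt f (fderiv ℂ f (toComplex x)) (toComplex x + (0 : ℂ) • toComplex t) := by
    simpa using (hf (toComplex x)).hasFDerivAt
  have h4 := h3.comp_hasDerivAt (0 : ℂ) h2
  rw [h1.fderiv]
  exact h4.deriv.symm

lemma line_ofReal (f : CSp m → ℂ) (x t : RSp m) (s : ℝ) :
    f (toComplex x + (s : ℂ) • toComplex t) = restr f (x + s • t) := by
  have : toComplex (x + s • t) = toComplex x + (s : ℂ) • toComplex t := by
    ext j; simp [toComplex]
  rw [restr, this]

lemma le_unifNorm {g : RSp m → ℂ} (hg : BddAbove (range fun x => ‖g x‖)) (x : RSp m) :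
    ‖g x‖ ≤ unifNorm g := le_ciSup hg x

lemma unifNorm_nonneg (g : RSp m → ℂ) : 0 ≤ unifNorm g :=
  Real.iSup_nonneg fun _ => norm_nonneg _

/-- The restriction of a function of exponential type `V` to a complex line with direction in `K^*`
is of exponential type `M(K, V)`. -/
lemma line_growth (hm : 1 ≤ m) (hK : IsSymmConvexBody K) (hV : IsSymmConvexBody V)
    {f : CSp m → ℂ} (hf : f ∈ expTypeFun V) (x : RSp m) {t : RSp m} (ht : t ∈ polarBody K)
    {τ : ℝ} (hτ : bernsteinConst K V < τ) :
    ∃ C, ∀ z : ℂ, ‖f (toComplex x + z • toComplex t)‖ ≤ C * Real.exp (τ * ‖z‖) := by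
  have hM := bernsteinConst_pos hm hK hV
  -- The choice of `ε` makes `1 + ε = τ / M`, whose denominator cancels the `M` bounding the pairing
  -- of `t` with points of `V`.
  obtain ⟨C, hC, h⟩ := hf.2 (τ / bernsteinConst K V - 1) (by
    rw [sub_pos, one_lt_div hM]; exact hτ)
  rw [add_sub_cancel] at h
  refine ⟨C * Real.exp (τ / bernsteinConst K V * dualNorm V (toComplex x)), fun z => ?_⟩
  refine (h _).trans ?_
  rw [mul_assoc, ← Real.exp_add]
  have hτ0 : 0 < τ := hM.trans hτ
  have hd : dualNorm V (toComplex x + z • toComplex t) ≤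
      dualNorm V (toComplex x) + ‖z‖ * bernsteinConst K V := by
    refine dualNorm_le (add_nonneg (dualNorm_nonneg _ _) (by positivity)) fun s hs => ?_
    rw [pairing_add, pairing_smul]
    refine (norm_add_le _ _).trans (add_le_add (le_dualNorm hV.isCompact hs _) ?_)
    rw [norm_mul, pairing_toComplex, Complex.norm_real, pairing_comm]
    exact mul_le_mul_of_nonneg_left (norm_pairing_le_bernsteinConst hm hK hV ht hs)
      (norm_nonneg _)
  gcongr
  calc _ ≤ τ / bernsteinConst K V * (dualNorm V (toComplex x) + ‖z‖ * bernsteinConst K V) := by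
        gcongr
    _ = _ := by field_simp

lemma bernstein_ineq (hm : 1 ≤ m) (hK : IsSymmConvexBody K) (hV : IsSymmConvexBody V)
    {f : CSp m → ℂ} (hf : f ∈ bddExpTypeFun V) (x : RSp m) :
    bodyNorm K (grad (restr f) x) ≤ bernsteinConst K V * unifNorm (restr f) := by
  have hM := bernsteinConst_pos hm hK hV
  refine dualNorm_le (mul_nonneg hM.le (unifNorm_nonneg _)) fun t ht => ?_
  rw [pairing_grad, fderiv_restr hf.1.1]
  refine bernstein_of_forall (differentiable_line hf.1.1 _ _) hM.le
    (fun τ hτ => line_growth hm hK hV hf.1 x ht hτ) fun s => ?_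
  rw [line_ofReal f]
  exact le_unifNorm hf.2.2 _

lemma fderiv_im_eq_zero {g : RSp m → ℂ} (hg : ∀ x, (g x).im = 0) (x t : RSp m) :
    (fderiv ℝ g x t).im = 0 := by
  by_cases hd : DifferentiableAt ℝ g x
  · have h1 := Complex.imCLM.hasFDerivAt.comp x hd.hasFDerivAt
    have h2 : (Complex.imCLM ∘ g) = fun _ => 0 := funext hg
    rw [h2] at h1
    have h3 := h1.unique (hasFDerivAt_const (0 : ℝ) x)
    exact DFunLike.congr_fun h3 t
  · simp [fderiv_zero_of_not_differentiableAt hd]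

lemma duffin_schaeffer_ineq (hm : 1 ≤ m) (hK : IsSymmConvexBody K) (hV : IsSymmConvexBody V)
    {f : CSp m → ℂ} (hf : f ∈ bddExpTypeFun V) (hreal : IsRealValued f) (x : RSp m) :
    bodyNorm K (grad (restr f) x) ^ 2 + bernsteinConst K V ^ 2 * (restr f x).re ^ 2 ≤
      bernsteinConst K V ^ 2 * unifNorm (restr f) ^ 2 := by
  have hM := bernsteinConst_pos hm hK hV
  have key : ∀ t ∈ polarBody K, ‖pairing t (grad (restr f) x)‖ ^ 2 ≤
      bernsteinConst K V ^ 2 * unifNorm (restr f) ^ 2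
        - bernsteinConst K V ^ 2 * (restr f x).re ^ 2 := by
    intro t ht
    have h := duffin_schaeffer_of_forall
      (differentiable_line hf.1.1 (toComplex x) (toComplex t)) hM.le
      (fun τ hτ => line_growth hm hK hV hf.1 x ht hτ) (B := unifNorm (restr f)) (fun s => by
        rw [line_ofReal f]
        exact le_unifNorm hf.2.2 _)
    have h0 : f (toComplex x + (0 : ℂ) • toComplex t) = restr f x := by simp [restr]
    rw [h0, ← fderiv_restr hf.1.1] at h
    -- For real-valued `f` the directional derivative is real, so its modulus is the real part
    -- already bounded.
    rw [pairing_grad, ← Complex.normSq_eq_norm_sq, Complex.normSq_apply,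
      fderiv_im_eq_zero hreal]
    linarith
  have h1 : bodyNorm K (grad (restr f) x) ≤ Real.sqrt
      (bernsteinConst K V ^ 2 * unifNorm (restr f) ^ 2
        - bernsteinConst K V ^ 2 * (restr f x).re ^ 2) :=
    dualNorm_le (Real.sqrt_nonneg _) fun t ht => Real.le_sqrt_of_sq_le (key t ht)
  have h2 : bodyNorm K (grad (restr f) x) ^ 2 ≤ _ :=
    pow_le_pow_left₀ (dualNorm_nonneg _ _) h1 2
  -- The point `0 ∈ K^*` shows that the quantity under the root is nonnegative.
  have h3 := (sq_nonneg _).trans (key 0 (by simp [mem_polarBody]))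
  rw [Real.sq_sqrt h3] at h2
  linarith

end Gradient

/-! ### Plane waves, the extremal functions. -/

section Waves

open Set

variable {m : ℕ} {K V : Set (RSp m)}

lemma differentiable_pairing (a : RSp m) : Differentiable ℂ fun z : CSp m => pairing a z := by
  unfold pairing
  fun_prop

lemma differentiable_expWave (a : RSp m) (C₁ C₂ : ℂ) : Differentiable ℂ (expWave a C₁ C₂) := by
  have := differentiable_pairing a
  unfold expWave
  fun_prop

lemma restr_expWave (a : RSp m) (C₁ C₂ : ℂ) (x : RSp m) :
    restr (expWave a C₁ C₂) x = C₁ * Complex.exp (Complex.I * (pairing (𝕜 := ℝ) a x : ℝ))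
      + C₂ * Complex.exp (-(Complex.I * (pairing (𝕜 := ℝ) a x : ℝ))) := by
  rw [restr, expWave, pairing_toComplex]

lemma norm_exp_wave_le (C₁ C₂ : ℂ) (θ : ℝ) :
    ‖C₁ * Complex.exp (Complex.I * θ) + C₂ * Complex.exp (-(Complex.I * θ))‖ ≤ ‖C₁‖ + ‖C₂‖ := by
  refine (norm_add_le _ _).trans_eq ?_
  simp [Complex.norm_exp]

lemma exists_norm_exp_wave_eq (C₁ C₂ : ℂ) : ∃ θ : ℝ,
    ‖C₁ * Complex.exp (Complex.I * θ) + C₂ * Complex.exp (-(Complex.I * θ))‖ = ‖C₁‖ + ‖C₂‖ := by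
  -- This phase gives both summands the common argument `(arg C₁ + arg C₂) / 2`.
  refine ⟨(C₂.arg - C₁.arg) / 2, ?_⟩
  have h : C₁ * Complex.exp (Complex.I * ((C₂.arg - C₁.arg) / 2 : ℝ))
      + C₂ * Complex.exp (-(Complex.I * ((C₂.arg - C₁.arg) / 2 : ℝ)))
      = ((‖C₁‖ + ‖C₂‖ : ℝ) : ℂ) * Complex.exp (((C₁.arg + C₂.arg) / 2 : ℝ) * Complex.I) := by
    have h1 := Complex.norm_mul_exp_arg_mul_I C₁
    have h2 := Complex.norm_mul_exp_arg_mul_I C₂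
    generalize C₁.arg = α at *
    generalize C₂.arg = β at *
    have e1 : Complex.exp (α * Complex.I) * Complex.exp (Complex.I * ((β - α) / 2 : ℝ)) =
        Complex.exp (((α + β) / 2 : ℝ) * Complex.I) := by
      rw [← Complex.exp_add]
      push_cast
      ring_nf
    have e2 : Complex.exp (β * Complex.I) * Complex.exp (-(Complex.I * ((β - α) / 2 : ℝ))) =
        Complex.exp (((α + β) / 2 : ℝ) * Complex.I) := by
      rw [← Complex.exp_add]
      push_cast
      ring_nf
    rw [Complex.ofReal_add]
    linear_combination (‖C₁‖ : ℂ) * e1 - Complex.exp (Complex.I * ((β - α) / 2 : ℝ)) * h1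
      + (‖C₂‖ : ℂ) * e2 - Complex.exp (-(Complex.I * ((β - α) / 2 : ℝ))) * h2
  rw [h, norm_mul, Complex.norm_exp_ofReal_mul_I, mul_one, Complex.norm_real, Real.norm_eq_abs,
    abs_of_nonneg (by positivity)]

lemma exists_pairing_eq {a : RSp m} (ha : a ≠ 0) (θ : ℝ) :
    ∃ x : RSp m, pairing (𝕜 := ℝ) a x = θ := by
  refine ⟨(θ / ‖a‖ ^ 2) • a, ?_⟩
  rw [pairing_eq_inner, real_inner_smul_right, real_inner_self_eq_norm_sq]
  have := norm_pos_iff.2 ha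
  field_simp

lemma unifNorm_expWave {a : RSp m} (ha : a ≠ 0) (C₁ C₂ : ℂ) :
    unifNorm (restr (expWave a C₁ C₂)) = ‖C₁‖ + ‖C₂‖ := by
  have hle : ∀ x, ‖restr (expWave a C₁ C₂) x‖ ≤ ‖C₁‖ + ‖C₂‖ := fun x => by
    rw [restr_expWave]; exact norm_exp_wave_le _ _ _
  refine le_antisymm (ciSup_le hle) ?_
  obtain ⟨θ, hθ⟩ := exists_norm_exp_wave_eq C₁ C₂
  obtain ⟨x, rfl⟩ := exists_pairing_eq ha θ
  rw [← hθ, ← restr_expWave]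
  exact le_unifNorm ⟨_, by rintro _ ⟨x, rfl⟩; exact hle x⟩ x

lemma expWave_mem (hV : IsSymmConvexBody V) {a : RSp m} (ha : a ∈ V) (C₁ C₂ : ℂ) :
    expWave a C₁ C₂ ∈ bddExpTypeFun V := by
  refine ⟨⟨differentiable_expWave a C₁ C₂, fun ε hε => ⟨‖C₁‖ + ‖C₂‖ + 1, by positivity,
    fun z => ?_⟩⟩, continuous_restr (differentiable_expWave a C₁ C₂).continuous,
    ‖C₁‖ + ‖C₂‖, ?_⟩
  · have hd := dualNorm_nonneg V z
    have h0 : ‖pairing a z‖ ≤ (1 + ε) * dualNorm V z :=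
      (le_dualNorm hV.isCompact ha z).trans (by nlinarith)
    have hI : ‖Complex.I * pairing a z‖ = ‖pairing a z‖ := by simp
    have hexp : ∀ w : ℂ, ‖w‖ = ‖pairing a z‖ →
        ‖Complex.exp w‖ ≤ Real.exp ((1 + ε) * dualNorm V z) := by
      intro w hw
      rw [Complex.norm_exp]
      exact Real.exp_le_exp.2 ((Complex.re_le_norm w).trans (hw.le.trans h0))
    have h1 := hexp _ hI
    have h2 := hexp (-(Complex.I * pairing a z)) (by rw [norm_neg, hI])
    refine (norm_add_le _ _).trans ?_
    rw [norm_mul, norm_mul]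
    have := Real.exp_pos ((1 + ε) * dualNorm V z)
    nlinarith [mul_le_mul_of_nonneg_left h1 (norm_nonneg C₁),
      mul_le_mul_of_nonneg_left h2 (norm_nonneg C₂)]
  · rintro _ ⟨x, rfl⟩
    simp only [restr_expWave]
    exact norm_exp_wave_le _ _ _

lemma fderiv_expWave (a : RSp m) (C₁ C₂ : ℂ) (x t : RSp m) :
    fderiv ℝ (restr (expWave a C₁ C₂)) x t =
      Complex.I * (C₁ * Complex.exp (Complex.I * (pairing (𝕜 := ℝ) a x : ℝ))
        + (-C₂) * Complex.exp (-(Complex.I * (pairing (𝕜 := ℝ) a x : ℝ))))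
        * (pairing (𝕜 := ℝ) t a : ℝ) := by
  rw [fderiv_restr (differentiable_expWave a C₁ C₂), pairing_comm t a]
  simp only [expWave, pairing_add, pairing_smul, pairing_toComplex]
  generalize ((pairing (𝕜 := ℝ) a x : ℝ) : ℂ) = θ
  generalize ((pairing (𝕜 := ℝ) a t : ℝ) : ℂ) = p
  have h1 : HasDerivAt (fun z : ℂ => Complex.I * (θ + z * p)) (Complex.I * p) 0 := by
    simpa using (((hasDerivAt_id (0 : ℂ)).mul_const p).const_add θ).const_mul Complex.I
  have h2 := (h1.cexp.const_mul C₁).add (h1.neg.cexp.const_mul C₂)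
  refine (HasDerivAt.deriv h2).trans ?_
  simp only [zero_mul, add_zero, Pi.neg_apply]
  ring

/-- The gradient is `i a` times the wave with `C₂` replaced by `-C₂`, a sign change that leaves the
maximal modulus `‖C₁‖ + ‖C₂‖` unchanged. -/
lemma bodyNorm_grad_expWave (a : RSp m) (C₁ C₂ : ℂ) (x : RSp m) :
    bodyNorm K (grad (restr (expWave a C₁ C₂)) x) =
      ‖C₁ * Complex.exp (Complex.I * (pairing (𝕜 := ℝ) a x : ℝ))
        + (-C₂) * Complex.exp (-(Complex.I * (pairing (𝕜 := ℝ) a x : ℝ)))‖ * bodyNorm K a := by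
  refine dualNorm_eq_mul (norm_nonneg _) fun t => ?_
  rw [pairing_grad, fderiv_expWave, norm_mul, norm_mul, Complex.norm_I, one_mul,
    Complex.norm_real]

/-- The coefficients are conjugate, each of modulus `√(R₁² + R₂²) / 2`, so the results on
exponential waves apply. -/
lemma trigWave_eq_expWave (a : RSp m) (R₁ R₂ : ℝ) :
    trigWave a R₁ R₂ = expWave a ((R₁ - R₂ * Complex.I) / 2) ((R₁ + R₂ * Complex.I) / 2) := by
  ext z
  simp only [trigWave, expWave, Complex.cos, Complex.sin]
  ring_nf

lemma norm_add_mul_I_half (R₁ R₂ : ℝ) :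
    ‖(R₁ + R₂ * Complex.I) / 2‖ = Real.sqrt (R₁ ^ 2 + R₂ ^ 2) / 2 := by
  rw [norm_div, Complex.norm_add_mul_I]
  simp

lemma norm_sub_mul_I_half (R₁ R₂ : ℝ) :
    ‖(R₁ - R₂ * Complex.I) / 2‖ = Real.sqrt (R₁ ^ 2 + R₂ ^ 2) / 2 := by
  have := norm_add_mul_I_half R₁ (-R₂)
  simpa [sub_eq_add_neg] using this

lemma unifNorm_trigWave {a : RSp m} (ha : a ≠ 0) (R₁ R₂ : ℝ) :
    unifNorm (restr (trigWave a R₁ R₂)) = Real.sqrt (R₁ ^ 2 + R₂ ^ 2) := by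
  rw [trigWave_eq_expWave, unifNorm_expWave ha, norm_add_mul_I_half, norm_sub_mul_I_half,
    add_halves]

lemma isRealValued_trigWave (a : RSp m) (R₁ R₂ : ℝ) : IsRealValued (trigWave a R₁ R₂) := by
  intro x
  rw [restr, trigWave, pairing_toComplex, ← Complex.ofReal_cos, ← Complex.ofReal_sin,
    ← Complex.ofReal_mul, ← Complex.ofReal_mul, ← Complex.ofReal_add, Complex.ofReal_im]

lemma pairing_zero_right (a : RSp m) : pairing (𝕜 := ℝ) a 0 = 0 := by
  simp [pairing_eq_inner]

lemma restr_trigWave_zero (a : RSp m) (R₁ R₂ : ℝ) : restr (trigWave a R₁ R₂) 0 = R₁ := by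
  rw [restr, trigWave, pairing_toComplex, pairing_zero_right]
  simp

lemma bodyNorm_grad_trigWave_zero (a : RSp m) (R₁ R₂ : ℝ) :
    bodyNorm K (grad (restr (trigWave a R₁ R₂)) 0) = |R₂| * bodyNorm K a := by
  rw [trigWave_eq_expWave, bodyNorm_grad_expWave, pairing_zero_right]
  congr 1
  have : (R₁ - R₂ * Complex.I) / 2 * Complex.exp (Complex.I * (0 : ℝ))
      + -((R₁ + R₂ * Complex.I) / 2) * Complex.exp (-(Complex.I * (0 : ℝ)))
      = -(R₂ * Complex.I) := by
    simp only [Complex.ofReal_zero, mul_zero, neg_zero, Complex.exp_zero]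
    ring
  rw [this]
  simp

end Waves

end ExpType

/-! ### Assembly of the inequalities, equality cases and sharpness. -/

open ExpType
theorem corollary2p2 (m : ℕ) (hm : 1 ≤ m) (K V : Set (RSp m))
    (hK : IsSymmConvexBody K) (hV : IsSymmConvexBody V) :
    -- the set of extremal points is non-empty, so that the equality cases below are not vacuous
    (extremalPoints K V).Nonempty ∧
    -- (a) the inequality
    (∀ f ∈ bddExpTypeFun V, ∀ x : RSp m,
      bodyNorm K (grad (restr f) x) ≤ bernsteinConst K V * unifNorm (restr f)) ∧
    -- (a) equality
    (∀ a ∈ extremalPoints K V, ∀ C₁ C₂ : ℂ,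
      expWave a C₁ C₂ ∈ bddExpTypeFun V ∧
      unifNorm (restr (expWave a C₁ C₂)) = ‖C₁‖ + ‖C₂‖ ∧
      ∃ x₀ : RSp m,
        bodyNorm K (grad (restr (expWave a C₁ C₂)) x₀) =
          bernsteinConst K V * unifNorm (restr (expWave a C₁ C₂))) ∧
    -- (a) sharpness
    IsLeast {C : ℝ | ∀ f ∈ bddExpTypeFun V, ∀ x : RSp m,
      bodyNorm K (grad (restr f) x) ≤ C * unifNorm (restr f)} (bernsteinConst K V) ∧
    -- (b) the inequality
    (∀ f ∈ bddExpTypeFun V, IsRealValued f → ∀ x : RSp m,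
      bodyNorm K (grad (restr f) x) ^ 2 + bernsteinConst K V ^ 2 * (restr f x).re ^ 2 ≤
        bernsteinConst K V ^ 2 * unifNorm (restr f) ^ 2) ∧
    -- (b) equality
    (∀ a ∈ extremalPoints K V, ∃ x₀ : RSp m, ∀ R₁ R₂ : ℝ,
      trigWave a R₁ R₂ ∈ bddExpTypeFun V ∧ IsRealValued (trigWave a R₁ R₂) ∧
      unifNorm (restr (trigWave a R₁ R₂)) = Real.sqrt (R₁ ^ 2 + R₂ ^ 2) ∧
      bodyNorm K (grad (restr (trigWave a R₁ R₂)) x₀) ^ 2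
          + bernsteinConst K V ^ 2 * (restr (trigWave a R₁ R₂) x₀).re ^ 2 =
        bernsteinConst K V ^ 2 * unifNorm (restr (trigWave a R₁ R₂)) ^ 2) ∧
    -- (b) sharpness
    IsLeast {C : ℝ | 0 ≤ C ∧ ∀ f ∈ bddExpTypeFun V, IsRealValued f → ∀ x : RSp m,
      bodyNorm K (grad (restr f) x) ^ 2 + C ^ 2 * (restr f x).re ^ 2 ≤
        C ^ 2 * unifNorm (restr f) ^ 2} (bernsteinConst K V) := by
  have hM := bernsteinConst_pos hm hK hV
  have hne := extremalPoints_nonempty hm hK hV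
  have hmem : ∀ a ∈ extremalPoints K V, a ∈ V := fun a ha =>
    hV.isCompact.isClosed.frontier_subset ha.1
  have hane : ∀ a ∈ extremalPoints K V, a ≠ 0 := fun a ha =>
    ne_zero_of_mem_extremalPoints hm hK hV ha
  have hexp : ∀ a ∈ extremalPoints K V, ∀ C₁ C₂ : ℂ, ∃ x₀ : RSp m,
      bodyNorm K (grad (restr (expWave a C₁ C₂)) x₀) =
        bernsteinConst K V * unifNorm (restr (expWave a C₁ C₂)) := by
    intro a ha C₁ C₂
    obtain ⟨θ, hθ⟩ := exists_norm_exp_wave_eq C₁ (-C₂)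
    obtain ⟨x, rfl⟩ := exists_pairing_eq (hane a ha) θ
    refine ⟨x, ?_⟩
    rw [bodyNorm_grad_expWave, hθ, unifNorm_expWave (hane a ha), norm_neg, ha.2, mul_comm]
  have htrig : ∀ a ∈ extremalPoints K V, ∀ R₁ R₂ : ℝ, trigWave a R₁ R₂ ∈ bddExpTypeFun V := by
    intro a ha R₁ R₂
    rw [trigWave_eq_expWave]
    exact expWave_mem hV (hmem a ha) _ _
  refine ⟨hne, fun f hf x => bernstein_ineq hm hK hV hf x, fun a ha C₁ C₂ =>
    ⟨expWave_mem hV (hmem a ha) C₁ C₂, unifNorm_expWave (hane a ha) C₁ C₂, hexp a ha C₁ C₂⟩,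
    ⟨fun f hf x => bernstein_ineq hm hK hV hf x, fun C hC => ?_⟩,
    -- The origin serves every `R₁, R₂` at once: there the wave equals `R₁` and its gradient has
    -- norm `|R₂| M`.
    fun f hf hr x => duffin_schaeffer_ineq hm hK hV hf hr x, fun a ha => ⟨0, fun R₁ R₂ =>
      ⟨htrig a ha R₁ R₂, isRealValued_trigWave a R₁ R₂, unifNorm_trigWave (hane a ha) R₁ R₂, ?_⟩⟩,
    ⟨⟨hM.le, fun f hf hr x => duffin_schaeffer_ineq hm hK hV hf hr x⟩, fun C hC => ?_⟩⟩
  · obtain ⟨a, ha⟩ := hne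
    -- The single wave `e^{i(a,x)}` has norm `1` and forces `M ≤ C`.
    obtain ⟨x, hx⟩ := hexp a ha 1 0
    have h := hC _ (expWave_mem hV (hmem a ha) 1 0) x
    rw [hx, unifNorm_expWave (hane a ha)] at h
    simpa using h
  · rw [bodyNorm_grad_trigWave_zero, restr_trigWave_zero, unifNorm_trigWave (hane a ha), ha.2,
      Real.sq_sqrt (by positivity), Complex.ofReal_re, mul_pow, sq_abs]
    ring
  · obtain ⟨a, ha⟩ := hne
    -- The function `sin (a, x)` vanishes at `0`, so the term with `C² f²` drops out and `M² ≤ C²`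
    -- remains.
    have h := hC.2 _ (htrig a ha 0 1) (isRealValued_trigWave a 0 1) 0
    rw [bodyNorm_grad_trigWave_zero, restr_trigWave_zero, unifNorm_trigWave (hane a ha), ha.2] at h
    refine le_of_sq_le_sq ?_ hC.1
    simpa using h
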